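/- Let $(\Omega,\mathcal F,\mathbb P)$ be a probability space and let $L_0$ be the space of classes, modulo a.s. equality, of real-valued measurable functions on $\Omega$. Let $\Phi:\mathbb R\to\mathbb R$ be a finite coercive Young function, i.e. an even convex function with $\Phi(0)=0$ and $\lim_{x\to+\infty}\Phi(x)/x=+\infty$, and let $\Phi^*(y)=\sup_{x\in\mathbb R}(xy-\Phi(x))$ be its conjugate. Let $L_{\Phi^*}=\{\xi\in L_0:\ \exists \lambda>0 \text{ with } \mathbb E[\Phi^*(\lambda\xi)]<\infty\}$ be the associated Orlicz space, with the norm $\|\xi\|_{\Phi^*}=\inf\{\lambda>0:\ \mathbb E[\Phi^*(\xi/\lambda)]\le 1\}$. Assume that $\Phi$ satisfies the $\Delta_2$-condition $\limsup_{x\to\infty}\Phi(2x)/\Phi(x)<\infty$. Then for every sequence $(\xi_n)_n$ in $L_{\Phi^*}$ with $\sup_n\|\xi_n\|_{\Phi^*}<\infty$ there exist forward convex combinations $\bar\xi_n\in\operatorname{conv}(\xi_k;\,k\ge n)$ for all $n$, and a $\xi\in L_{\Phi^*}$, such that $\bar\xi_n\to\xi$ in order, i.e. $\sup_n|\bar\xi_n|\in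 L_{\Phi^*}$ and $\bar\xi_n\to\xi$ a.s. -/

import Mathlib

open MeasureTheory Filter Topology

/-- Finite coercive Young functions on the real line. -/
structure IsYoungFunction (Φ : ℝ → ℝ) : Prop where
  even : ∀ x, Φ (-x) = Φ x
  convex : ConvexOn ℝ Set.univ Φ
  map_zero : Φ 0 = 0
  coercive : Tendsto (fun x => Φ x / x) atTop atTop

/-- The `Δ₂`-condition: the limsup, as `x → ∞`, of `Φ (2x) / Φ x` (formed in the extended reals)
is finite. For a Young function the denominator is positive for all large `x`. -/
def SatisfiesDelta2 (Φ : ℝ → ℝ) : Prop :=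
  limsup (fun x : ℝ => ((Φ (2 * x) / Φ x : ℝ) : EReal)) atTop < ⊤

/-- The conjugate `Φ* (y) = sup_x (x y - Φ x)`. For a Young function the supremum is finite,
see `IsYoungFunction.bddAbove_conjugate`. -/
noncomputable def youngConjugate (Φ : ℝ → ℝ) (y : ℝ) : ℝ :=
  ⨆ x : ℝ, (x * y - Φ x)

theorem IsYoungFunction.nonneg {Φ : ℝ → ℝ} (h : IsYoungFunction Φ) (x : ℝ) : 0 ≤ Φ x := by
  have h1 : Φ ((1 / 2 : ℝ) • x + (1 / 2 : ℝ) • -x) ≤ (1 / 2 : ℝ) • Φ x + (1 / 2 : ℝ) • Φ (-x) :=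
    h.convex.2 (Set.mem_univ x) (Set.mem_univ (-x)) (by norm_num) (by norm_num) (by norm_num)
  simp only [smul_eq_mul, h.even] at h1
  rw [show (1 / 2 : ℝ) * x + 1 / 2 * -x = 0 by ring, h.map_zero] at h1
  linarith

/-- The supremum defining the conjugate is that of a set bounded above. -/
theorem IsYoungFunction.bddAbove_conjugate {Φ : ℝ → ℝ} (h : IsYoungFunction Φ) (y : ℝ) :
    BddAbove (Set.range fun x : ℝ => x * y - Φ x) := by
  obtain ⟨M, hM⟩ := eventually_atTop.1
    ((h.coercive.eventually_ge_atTop |y|).and (eventually_gt_atTop 0))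
  refine ⟨|M| * |y|, ?_⟩
  rintro _ ⟨x, rfl⟩
  have h1 : x * y ≤ |x| * |y| := by rw [← abs_mul]; exact le_abs_self _
  have h0 := h.nonneg x
  have hx : Φ |x| = Φ x := by
    rcases abs_choice x with hx | hx <;> rw [hx]
    exact h.even x
  show x * y - Φ x ≤ _
  rcases le_total M |x| with hx' | hx'
  · obtain ⟨h2, h3⟩ := hM _ hx'
    rw [le_div_iff₀ h3, hx] at h2
    have : 0 ≤ |M| * |y| := by positivity
    nlinarith
  · have : |x| * |y| ≤ |M| * |y| :=
      mul_le_mul_of_nonneg_right (hx'.trans (le_abs_self M)) (abs_nonneg y)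
    linarith

section Orlicz

variable {Ω : Type*} [MeasurableSpace Ω] {P : Measure Ω}

/-- The expectation `𝔼[Φ (ξ)] ∈ [0, ∞]` of the nonnegative random variable `Φ (ξ)`, where `ξ` is
a class, modulo almost sure equality, of real random variables. -/
noncomputable def orliczModular (Φ : ℝ → ℝ) (ξ : Ω →ₘ[P] ℝ) : ENNReal :=
  ∫⁻ ω, ENNReal.ofReal (Φ (ξ ω)) ∂P

/-- The set of all `ξ` in `L₀` with `𝔼[Φ (ξ)] ≤ 1`. -/
def orliczBall (Φ : ℝ → ℝ) (P : Measure Ω) : Set (Ω →ₘ[P] ℝ) :=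
  {ξ | orliczModular Φ ξ ≤ 1}

/-- The Orlicz space of all `ξ` in `L₀` such that `𝔼[Φ (c ξ)] < ∞` for some `c > 0`. -/
def orliczSpace (Φ : ℝ → ℝ) (P : Measure Ω) : Set (Ω →ₘ[P] ℝ) :=
  {ξ | ∃ c : ℝ, 0 < c ∧ orliczModular Φ (c • ξ) < ⊤}

/-- The Luxemburg norm: the infimum of all `c > 0` such that `ξ` lies in `c` times the ball.
For `ξ` in the Orlicz space of a Young function the set of such `c` is nonempty. -/
noncomputable def luxemburgNorm (Φ : ℝ → ℝ) (ξ : Ω →ₘ[P] ℝ) : ℝ :=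
  sInf {c : ℝ | 0 < c ∧ c⁻¹ • ξ ∈ orliczBall Φ P}

end Orlicz

/-!
Let `Ψ` be the conjugate of `Φ`, dilated so that `𝔼[Ψ (ξ n)] ≤ 1` for all `n`. The `Δ₂`-condition on
`Φ` says, after conjugation, that `2 ℓ Ψ y ≤ Ψ (ℓ y) + K` for some `ℓ > 1`
(`IsYoungFunction.exists_youngConjugate_growth`), so that `Ψ` grows at least like a power with an
exponent `p > 1`. Hence `Ψ` is equivalent, up to a dilation of the argument, a constant factor and
additive constants, to `H = h ^ p` with `h` even and convex
(`IsEvenConvex.exists_isUniformlyEvenConvex`). Strict convexity of `t ↦ t ^ p` makes `H` uniformly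
convex in a scale invariant sense: for every `ε > 0` there is a `K` such that
`H ((a - b) / 2) ≤ ε (H a + H b) + K ((H a + H b) / 2 - H ((a + b) / 2))`
(`IsEvenConvex.isUniformlyEvenConvex_rpow`).

Now minimise `𝔼[H (g)]` approximately over `g` in the convex hull of the `ξ k`, `k ≥ n`. The
midpoint of two almost minimisers is again a competitor, so their midpoint defect tends to `0`
(`exists_seq_midpoint_defect_le`), and the inequality above turns this into
`𝔼[H ((g n - g m) / 2)] → 0` (`IsUniformlyEvenConvex.exists_modular_cauchy`). As `H` dominates
`|y| ^ p`, a subsequence converges almost surely to some `g`, and by Fatou's lemma it can be chosen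
so that `∑ 𝔼[H ((g n - g) / 2)] < ∞`. This sum, together with `𝔼[H (g)]`, controls `H` of a multiple
of `sup |g n|` (`IsUniformlyEvenConvex.exists_order_convergent`).

The detour through `H` is needed since `Ψ` itself need be neither strictly convex nor doubling.
-/

/-! ### Even convex functions -/

/-- An even convex function on the line that vanishes at the origin. -/
structure IsEvenConvex (h : ℝ → ℝ) : Prop where
  even : ∀ x, h (-x) = h x
  convex : ConvexOn ℝ Set.univ h
  map_zero : h 0 = 0

namespace IsEvenConvex

variable {h : ℝ → ℝ}

theorem le_of_abs_le (hh : IsEvenConvex h) {x y : ℝ} (hxy : |x| ≤ |y|) : h x ≤ h y := by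
  have h1 := hh.convex.le_max_of_mem_Icc (Set.mem_univ (-|y|)) (Set.mem_univ |y|)
    (z := x) (abs_le.1 hxy)
  rw [hh.even, max_self] at h1
  rcases abs_choice y with hy | hy
  · rwa [hy] at h1
  · rwa [hy, hh.even] at h1

theorem nonneg (hh : IsEvenConvex h) (x : ℝ) : 0 ≤ h x := by
  rw [← hh.map_zero]
  exact hh.le_of_abs_le (by simp)

theorem map_mul_le (hh : IsEvenConvex h) {s : ℝ} (hs0 : 0 ≤ s) (hs1 : s ≤ 1) (x : ℝ) :
    h (s * x) ≤ s * h x := by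
  have := hh.convex.2 (Set.mem_univ x) (Set.mem_univ 0) hs0 (sub_nonneg.2 hs1) (by ring)
  simpa [hh.map_zero] using this

theorem map_midpoint_le (hh : IsEvenConvex h) (x y : ℝ) :
    h ((x + y) / 2) ≤ (h x + h y) / 2 := by
  have := hh.convex.2 (Set.mem_univ x) (Set.mem_univ y)
    (by norm_num : (0 : ℝ) ≤ 1 / 2) (by norm_num : (0 : ℝ) ≤ 1 / 2) (by norm_num)
  simp only [smul_eq_mul] at this
  rw [show (x + y) / 2 = 1 / 2 * x + 1 / 2 * y by ring]
  linarith

theorem map_half_sub_le (hh : IsEvenConvex h) (x y : ℝ) :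
    h ((x - y) / 2) ≤ (h x + h y) / 2 := by
  have := hh.map_midpoint_le x (-y)
  rwa [hh.even, ← sub_eq_add_neg] at this

theorem continuous (hh : IsEvenConvex h) : Continuous h :=
  continuousOn_univ.1 (hh.convex.continuousOn isOpen_univ)

theorem comp_mul (hh : IsEvenConvex h) (s : ℝ) : IsEvenConvex fun x => h (s * x) where
  even x := by rw [mul_neg, hh.even]
  convex := by
    simpa using! hh.convex.comp_linearMap (LinearMap.mulLeft ℝ s)
  map_zero := by simp [hh.map_zero]

theorem add {k : ℝ → ℝ} (hh : IsEvenConvex h) (hk : IsEvenConvex k) :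
    IsEvenConvex fun x => h x + k x where
  even x := by rw [hh.even, hk.even]
  convex := hh.convex.add hk.convex
  map_zero := by simp [hh.map_zero, hk.map_zero]

theorem rpow (hh : IsEvenConvex h) {p : ℝ} (hp : 1 < p) : IsEvenConvex fun x => h x ^ p where
  even x := by rw [hh.even]
  convex := by
    refine ⟨convex_univ, fun x _ y _ a b ha hb hab => ?_⟩
    refine (Real.rpow_le_rpow (hh.nonneg _)
      (hh.convex.2 (Set.mem_univ x) (Set.mem_univ y) ha hb hab) (by linarith)).trans ?_
    exact (convexOn_rpow hp.le).2 (hh.nonneg x) (hh.nonneg y) ha hb hab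
  map_zero := by rw [hh.map_zero, Real.zero_rpow (by linarith)]

end IsEvenConvex

theorem isEvenConvex_abs : IsEvenConvex fun x : ℝ => |x| where
  even := abs_neg
  convex := by simpa using! (convexOn_univ_norm (E := ℝ))
  map_zero := abs_zero

/-! ### Uniform convexity of powers -/

/-- An even convex function `H`, vanishing at `0`, such that up to an arbitrarily small multiple of
`H a + H b` the value of `H` at half the difference of `a` and `b` is controlled by the defect of
midpoint convexity at `a`, `b`. It is a uniform convexity property that is scale invariant,
and it survives integration. -/
structure IsUniformlyEvenConvex (H : ℝ → ℝ) : Prop extends IsEvenConvex H where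
  defect : ∀ ε > 0, ∃ K, 0 ≤ K ∧ ∀ a b,
    H ((a - b) / 2) ≤ ε * (H a + H b) + K * ((H a + H b) / 2 - H ((a + b) / 2))

/-- Quantitative strict convexity of `t ↦ t ^ p` between points whose ratio stays away from `1`. -/
theorem exists_rpow_midpoint_le {p : ℝ} (hp : 1 < p) {ε : ℝ} (hε0 : 0 < ε) (hε1 : ε ≤ 1) :
    ∃ δ > 0, ∀ u v : ℝ, 0 ≤ u → 0 ≤ v → v ≤ (1 - ε) * u →
      ((u + v) / 2) ^ p ≤ (1 - δ) * ((u ^ p + v ^ p) / 2) := by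
  have hp0 : 0 < p := by linarith
  obtain ⟨s, hs, hmin⟩ := (isCompact_Icc (a := (0 : ℝ)) (b := 1 - ε)).exists_isMinOn
    ⟨0, by constructor <;> linarith⟩
    (f := fun s : ℝ => (1 + s ^ p) / 2 - ((1 + s) / 2) ^ p)
    (by
      apply Continuous.continuousOn
      have h1 : Continuous fun s : ℝ => s ^ p := Real.continuous_rpow_const hp0.le
      have h2 : Continuous fun s : ℝ => ((1 + s) / 2) ^ p := h1.comp (by fun_prop)
      exact ((continuous_const.add h1).div_const 2).sub h2)
  have hδ : 0 < (1 + s ^ p) / 2 - ((1 + s) / 2) ^ p := by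
    have := (strictConvexOn_rpow hp).2 (Set.mem_Ici.2 zero_le_one) (Set.mem_Ici.2 hs.1)
      (by linarith [hs.2])
      (by norm_num : (0 : ℝ) < 1 / 2) (by norm_num : (0 : ℝ) < 1 / 2) (by norm_num)
    simp only [smul_eq_mul, Real.one_rpow] at this
    rw [show (1 / 2 : ℝ) * 1 + 1 / 2 * s = (1 + s) / 2 by ring] at this
    linarith
  refine ⟨_, hδ, fun u v hu hv huv => ?_⟩
  set δ := (1 + s ^ p) / 2 - ((1 + s) / 2) ^ p
  rcases eq_or_lt_of_le hu with hu | hu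
  · have : v = 0 := by rw [← hu] at huv; linarith
    simp [← hu, this, Real.zero_rpow hp0.ne']
  · have hr0 : 0 ≤ v / u := by positivity
    have hr1 : v / u ≤ 1 - ε := by rwa [div_le_iff₀ hu]
    have h1 : δ ≤ (1 + (v / u) ^ p) / 2 - ((1 + v / u) / 2) ^ p := hmin ⟨hr0, hr1⟩
    have h2 : (v / u) ^ p ≤ 1 := Real.rpow_le_one hr0 (by linarith) hp0.le
    have h4 : ((1 + v / u) / 2) ^ p ≤ (1 - δ) * ((1 + (v / u) ^ p) / 2) := by nlinarith
    have e1 : (u + v) / 2 = u * ((1 + v / u) / 2) := by field_simp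
    have e2 : v ^ p = u ^ p * (v / u) ^ p := by
      rw [← Real.mul_rpow hu.le hr0, mul_div_cancel₀ _ hu.ne']
    rw [e1, Real.mul_rpow hu.le (by positivity), e2]
    calc _ ≤ u ^ p * ((1 - δ) * ((1 + (v / u) ^ p) / 2)) := by gcongr
      _ = _ := by ring

/-- The power `h ^ p` of an even convex function is uniformly convex: for nearly equal arguments
the difference is small, and otherwise either the values of `h` have a ratio away from `1`, or the
arguments have opposite signs and the midpoint is at most half the larger one. -/
theorem IsEvenConvex.isUniformlyEvenConvex_rpow {h : ℝ → ℝ} (hh : IsEvenConvex h) {p : ℝ}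
    (hp : 1 < p) : IsUniformlyEvenConvex fun x => h x ^ p := by
  have hp0 : 0 < p := by linarith
  refine ⟨hh.rpow hp, fun ε hε => ?_⟩
  have hH := hh.rpow hp
  set η := min ε 1
  have hη0 : 0 < η := lt_min hε one_pos
  have hη1 : η ≤ 1 := min_le_right _ _
  obtain ⟨δ, hδ, hδ'⟩ := exists_rpow_midpoint_le hp hη0 hη1
  refine ⟨1 / δ, by positivity, fun a b => ?_⟩
  wlog hab : |b| ≤ |a| generalizing a b
  · have := this b a (le_of_not_ge hab)
    rw [show (a - b) / 2 = -((b - a) / 2) by ring, add_comm a b, hh.even]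
    linarith
  have ha := hH.nonneg a
  have hb := hH.nonneg b
  have hdef : 0 ≤ (h a ^ p + h b ^ p) / 2 - h ((a + b) / 2) ^ p := by
    have := hH.map_midpoint_le a b
    linarith
  rcases le_or_gt |a - b| (η * |a|) with hd | hd
  · have h1 : h ((a - b) / 2) ^ p ≤ h (η * a) ^ p := hH.le_of_abs_le (by
      rw [abs_div, abs_mul, abs_of_pos hη0, abs_two]
      linarith [abs_nonneg (a - b)])
    have h2 : h (η * a) ^ p ≤ η * h a ^ p := hH.map_mul_le hη0.le hη1 a
    have h3 : η * h a ^ p ≤ ε * (h a ^ p + h b ^ p) := by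
      have : η ≤ ε := min_le_left _ _
      nlinarith
    have : 0 ≤ 1 / δ * ((h a ^ p + h b ^ p) / 2 - h ((a + b) / 2) ^ p) := by positivity
    linarith
  · have hmid : h ((a + b) / 2) ^ p ≤ (1 - δ) * ((h a ^ p + h b ^ p) / 2) := by
      rcases le_or_gt 0 (a * b) with hs | hs
      · have h1 : |b| ≤ (1 - η) * |a| := by
          have h3 : |a - b| ≤ |a| - |b| := by
            refine abs_le_of_sq_le_sq ?_ (by linarith)
            have : |a| * |b| = a * b := by rw [← abs_mul, abs_of_nonneg hs]
            nlinarith [sq_abs a, sq_abs b]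
          linarith
        have h2 : h b ≤ (1 - η) * h a := by
          refine (hh.le_of_abs_le (y := (1 - η) * a) ?_).trans
            (hh.map_mul_le (by linarith) (by linarith) a)
          rwa [abs_mul, abs_of_nonneg (by linarith : (0 : ℝ) ≤ 1 - η)]
        exact (Real.rpow_le_rpow (hh.nonneg _) (hh.map_midpoint_le a b) hp0.le).trans
          (hδ' _ _ (hh.nonneg a) (hh.nonneg b) h2)
      · have h1 : h ((a + b) / 2) ≤ (h a + 0) / 2 := by
          refine (hh.le_of_abs_le (y := 1 / 2 * a) ?_).trans
            ((hh.map_mul_le (by norm_num) (by norm_num) a).trans (by linarith))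
          rw [abs_div, abs_mul, abs_two, abs_of_pos (by norm_num : (0 : ℝ) < 1 / 2)]
          have : |a + b| ≤ |a| := by
            apply sq_le_sq.1
            have : |b| * |b| ≤ |a * b| := by rw [abs_mul]; gcongr
            rw [abs_of_neg hs, abs_mul_abs_self] at this
            nlinarith
          linarith
        have h2 := hδ' (h a) 0 (hh.nonneg a) le_rfl (mul_nonneg (by linarith) (hh.nonneg a))
        have h3 := Real.rpow_le_rpow (hh.nonneg _) h1 hp0.le
        have h4 : 0 ≤ 1 - δ := by
          have := hδ' 1 0 zero_le_one le_rfl (by linarith)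
          have h5 : (0 : ℝ) ≤ ((1 + 0) / 2) ^ p := by positivity
          rw [Real.zero_rpow hp0.ne', Real.one_rpow] at this
          linarith
        rw [Real.zero_rpow hp0.ne'] at h2
        nlinarith
    have h1 : h ((a - b) / 2) ^ p ≤ (h a ^ p + h b ^ p) / 2 := hH.map_half_sub_le a b
    have h2 : (h a ^ p + h b ^ p) / 2
        ≤ 1 / δ * ((h a ^ p + h b ^ p) / 2 - h ((a + b) / 2) ^ p) := by
      rw [one_div, ← div_eq_inv_mul, le_div_iff₀ hδ]
      linarith
    have : 0 ≤ ε * (h a ^ p + h b ^ p) := by positivity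
    linarith

/-! ### Regularisation of functions of superlinear growth -/

/-- If `ρ t / t` is nondecreasing on `(0, ∞)` up to a constant factor, then the even function `ρ`
is equivalent to a convex one, namely to the supremum over `t > 0` of `ρ t / t * (|y| - t)⁺`. -/
theorem exists_isEvenConvex_equiv {ρ : ℝ → ℝ} {L : ℝ} (hρ : ∀ t, 0 ≤ ρ t)
    (heven : ∀ t, ρ (-t) = ρ t) (h0 : ρ 0 = 0) (hL : 0 ≤ L)
    (hmono : ∀ t y, 0 < t → t ≤ y → ρ t / t ≤ L * (ρ y / y)) :
    ∃ h : ℝ → ℝ, IsEvenConvex h ∧ (∀ y, h y ≤ L * ρ y) ∧ ∀ y, ρ y ≤ h (2 * y) := by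
  have habs : ∀ y, ρ |y| = ρ y := fun y => by
    rcases abs_choice y with hy | hy <;> rw [hy]
    exact heven y
  have hle : ∀ (y : ℝ) (t : Set.Ioi (0 : ℝ)),
      ρ t / t * max (|y| - t) 0 ≤ L * ρ y := by
    rintro y ⟨t, ht⟩
    have ht : 0 < t := ht
    have h1 := mul_nonneg hL (hρ y)
    rcases le_total |y| t with hy | hy
    · simpa [max_eq_right (sub_nonpos.2 hy)] using h1
    · have hy0 : 0 < |y| := ht.trans_le hy
      calc ρ t / t * max (|y| - t) 0 ≤ L * (ρ |y| / |y|) * |y| := by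
            have := hmono t |y| ht hy
            have h2 : max (|y| - t) 0 ≤ |y| := max_le (by linarith) hy0.le
            exact mul_le_mul this h2 (le_max_right _ _)
              (mul_nonneg hL (div_nonneg (hρ _) hy0.le))
        _ = L * ρ y := by rw [habs]; field_simp
  have hbdd : ∀ y, BddAbove (Set.range fun t : Set.Ioi (0 : ℝ) =>
      ρ t / t * max (|y| - (t : ℝ)) 0) := fun y => ⟨L * ρ y, by rintro _ ⟨t, rfl⟩; exact hle y t⟩
  have : Nonempty (Set.Ioi (0 : ℝ)) := ⟨⟨1, Set.mem_Ioi.2 one_pos⟩⟩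
  refine ⟨fun y => ⨆ t : Set.Ioi (0 : ℝ), ρ t / t * max (|y| - t) 0,
    ⟨fun y => by simp only [abs_neg], ⟨convex_univ, ?_⟩, ?_⟩, fun y => ciSup_le (hle y), ?_⟩
  · intro x _ y _ a b ha hb hab
    refine ciSup_le fun t => ?_
    have ht : (0 : ℝ) < t := t.2
    have h1 : max (|a • x + b • y| - (t : ℝ)) 0
        ≤ a * max (|x| - (t : ℝ)) 0 + b * max (|y| - (t : ℝ)) 0 := by
      have hx := mul_le_mul_of_nonneg_left (le_max_left (|x| - (t : ℝ)) 0) ha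
      have hy := mul_le_mul_of_nonneg_left (le_max_left (|y| - (t : ℝ)) 0) hb
      refine max_le ?_ (by positivity)
      have h2 := abs_add_le (a • x) (b • y)
      rw [smul_eq_mul, smul_eq_mul, abs_mul, abs_mul, abs_of_nonneg ha, abs_of_nonneg hb] at h2
      have h3 : (t : ℝ) = a * t + b * t := by rw [← add_mul, hab, one_mul]
      rw [smul_eq_mul, smul_eq_mul]
      linarith
    calc _ ≤ ρ t / t * (a * max (|x| - (t : ℝ)) 0 + b * max (|y| - (t : ℝ)) 0) :=
          mul_le_mul_of_nonneg_left h1 (div_nonneg (hρ t) ht.le)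
      _ = a * (ρ t / t * max (|x| - (t : ℝ)) 0) + b * (ρ t / t * max (|y| - (t : ℝ)) 0) := by ring
      _ ≤ _ := by
          simp only [smul_eq_mul]
          gcongr
          · exact le_ciSup (hbdd x) t
          · exact le_ciSup (hbdd y) t
  · have h1 : ∀ t : Set.Ioi (0 : ℝ), ρ t / t * max (|(0 : ℝ)| - t) 0 = 0 := fun t => by
      have ht : (0 : ℝ) < t := t.2
      rw [abs_zero, max_eq_right (by linarith), mul_zero]
    simp only [h1, ciSup_const]
  · intro y
    rcases eq_or_ne y 0 with rfl | hy
    · rw [h0]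
      exact Real.iSup_nonneg fun t =>
        mul_nonneg (div_nonneg (hρ _) (le_of_lt t.2)) (le_max_right _ _)
    · have hy0 : 0 < |y| := abs_pos.2 hy
      refine le_trans (le_of_eq ?_) (le_ciSup (hbdd (2 * y)) ⟨|y|, hy0⟩)
      rw [abs_mul, abs_two, two_mul, add_sub_cancel_right, max_eq_left hy0.le, habs,
        div_mul_cancel₀ _ hy0.ne']

/-- A growth inequality for one dilation factor propagates to power growth with the same exponent. -/
theorem rpow_mul_le_of_growth {F : ℝ → ℝ} {ℓ p : ℝ} (hF : MonotoneOn F (Set.Ici 0))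
    (h0 : ∀ y, 0 ≤ F y) (hℓ : 1 < ℓ) (hp : 0 < p)
    (hgrow : ∀ y, ℓ ^ p * F y ≤ F (ℓ * y)) {y t : ℝ} (hy : 0 < y) (hyt : y ≤ t) :
    (t / y) ^ p * F y ≤ ℓ ^ p * F t := by
  have hℓ0 : 0 < ℓ := by linarith
  obtain ⟨n, hn1, hn2⟩ := exists_nat_pow_near ((one_le_div hy).2 hyt) hℓ
  have hiter : ∀ k : ℕ, (ℓ ^ k) ^ p * F y ≤ F (ℓ ^ k * y) := by
    intro k
    induction k with
    | zero => simp
    | succ k ih =>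
      calc (ℓ ^ (k + 1)) ^ p * F y = ℓ ^ p * ((ℓ ^ k) ^ p * F y) := by
            rw [pow_succ', Real.mul_rpow hℓ0.le (by positivity), mul_assoc]
        _ ≤ ℓ ^ p * F (ℓ ^ k * y) := by gcongr
        _ ≤ F (ℓ ^ (k + 1) * y) := by rw [pow_succ', mul_assoc]; exact hgrow _
  calc (t / y) ^ p * F y ≤ (ℓ ^ (n + 1)) ^ p * F y := by
        have := h0 y
        have : 0 ≤ t / y := div_nonneg (hy.le.trans hyt) hy.le
        gcongr
    _ = ℓ ^ p * ((ℓ ^ n) ^ p * F y) := by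
        rw [pow_succ', Real.mul_rpow hℓ0.le (by positivity), mul_assoc]
    _ ≤ ℓ ^ p * F t := by
        gcongr
        refine (hiter n).trans (hF (Set.mem_Ici.2 (by positivity))
          (Set.mem_Ici.2 (hy.le.trans hyt)) ?_)
        rwa [le_div_iff₀ hy] at hn1

/-- If `Ψ (ℓ y)` dominates `2 ℓ Ψ y` up to a constant, then `Ψ` is equivalent, up to a dilation, a
constant factor and additive constants, to a uniformly convex function, which can be chosen to
dominate a power `|y| ^ p` with `p > 1`. -/
theorem IsEvenConvex.exists_isUniformlyEvenConvex {Ψ : ℝ → ℝ} (hΨ : IsEvenConvex Ψ) {ℓ K : ℝ}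
    (hℓ : 1 < ℓ) (hK : ∀ y, 2 * ℓ * Ψ y ≤ Ψ (ℓ * y) + K) (htop : ∀ M, ∃ t, M < Ψ t) :
    ∃ (p : ℝ) (H : ℝ → ℝ) (A B : ℝ), 1 < p ∧ IsUniformlyEvenConvex H ∧ (∀ y, |y| ^ p ≤ H y) ∧
      (∀ y, H y ≤ A * (Ψ y + 1)) ∧ ∀ y, Ψ (1 / 2 * y) ≤ H y + B := by
  set p := Real.logb ℓ (2 * ℓ)
  have hp : 1 < p := by
    rw [Real.lt_logb_iff_rpow_lt hℓ (by linarith), Real.rpow_one]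
    linarith
  have hp0 : 0 < p := by linarith
  have hℓp : ℓ ^ p = 2 * ℓ := Real.rpow_logb (by linarith) hℓ.ne' (by linarith)
  -- `F = (Ψ - c)⁺` satisfies the growth inequality without an additive constant
  set c := |K| / (2 * ℓ - 1)
  have hc0 : 0 ≤ c := div_nonneg (abs_nonneg K) (by linarith)
  have hc : (2 * ℓ - 1) * c = |K| := mul_div_cancel₀ |K| (show 2 * ℓ - 1 ≠ 0 by linarith)
  set F : ℝ → ℝ := fun y => max (Ψ y - c) 0
  have hF0 : ∀ y, 0 ≤ F y := fun y => le_max_right _ _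
  have hFmono : MonotoneOn F (Set.Ici 0) := fun x hx y hy hxy => by
    have hx : 0 ≤ x := hx
    have := hΨ.le_of_abs_le (x := x) (y := y) (by rwa [abs_of_nonneg hx, abs_of_nonneg hy])
    exact max_le_max (by linarith) le_rfl
  have hFgrow : ∀ y, ℓ ^ p * F y ≤ F (ℓ * y) := fun y => by
    rw [hℓp]
    rcases le_total (Ψ y - c) 0 with hy | hy
    · simp only [F, max_eq_right hy, mul_zero]
      exact le_max_right _ _
    · simp only [F, max_eq_left hy]
      refine le_trans ?_ (le_max_left _ _)
      have := hK y
      have := le_abs_self K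
      linarith
  have hFpow : ∀ t y, 0 < t → t ≤ y → (y / t) ^ p * F t ≤ ℓ ^ p * F y := fun t y ht hty =>
    rpow_mul_le_of_growth hFmono hF0 hℓ hp0 hFgrow ht hty
  set ρ : ℝ → ℝ := fun y => F y ^ p⁻¹
  have hρ0 : ∀ y, 0 ≤ ρ y := fun y => Real.rpow_nonneg (hF0 y) _
  have hρp : ∀ y, ρ y ^ p = F y := fun y => Real.rpow_inv_rpow (hF0 y) hp0.ne'
  obtain ⟨h, hh, hup, hlow⟩ := exists_isEvenConvex_equiv (ρ := ρ) (L := ℓ) hρ0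
    (fun t => by simp only [ρ, F, hΨ.even])
    (by simp only [ρ, F, hΨ.map_zero, max_eq_right (show 0 - c ≤ 0 by linarith)]
        exact Real.zero_rpow (inv_pos.2 hp0).ne')
    (by linarith)
    (fun t y ht hty => by
      have hy : 0 < y := ht.trans_le hty
      have h1 : (y / t * ρ t) ^ p ≤ (ℓ * ρ y) ^ p := by
        rw [Real.mul_rpow (by positivity) (hρ0 t), Real.mul_rpow (by linarith) (hρ0 y), hρp, hρp]
        exact hFpow t y ht hty
      have h2 := (Real.rpow_le_rpow_iff (mul_nonneg (by positivity) (hρ0 t))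
        (mul_nonneg (by linarith) (hρ0 y)) hp0).1 h1
      rw [← mul_div_assoc, le_div_iff₀ hy]
      calc _ = y / t * ρ t := by ring
        _ ≤ _ := h2)
  -- `h` grows at least linearly away from the origin
  obtain ⟨D, hD0, hD⟩ : ∃ D, 0 ≤ D ∧ ∀ y, |y| ≤ D * (h y + 1) := by
    obtain ⟨t, ht⟩ := htop c
    have hFt : 0 < h (2 * t) :=
      (Real.rpow_pos_of_pos (lt_max_of_lt_left (by linarith)) _).trans_le (hlow t)
    have ht0 : 2 * t ≠ 0 := fun h0 => by rw [h0, hh.map_zero] at hFt; exact hFt.false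
    have hs : 0 < |2 * t| := abs_pos.2 ht0
    refine ⟨|2 * t| + |2 * t| / h (2 * t), by positivity, fun y => ?_⟩
    have hy := hh.nonneg y
    have hq : 0 ≤ |2 * t| / h (2 * t) := by positivity
    rcases le_total |y| |2 * t| with hle | hle
    · nlinarith [mul_nonneg hs.le hy, mul_nonneg hq hy]
    · have hy0 : 0 < |y| := hs.trans_le hle
      have h1 : h (2 * t) ≤ |2 * t| / |y| * h y := by
        refine le_trans (hh.le_of_abs_le (y := |2 * t| / |y| * y) ?_)
          (hh.map_mul_le (by positivity) ((div_le_one hy0).2 hle) y)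
        rw [abs_mul (_ / _), abs_div, abs_abs, abs_abs, div_mul_cancel₀ _ hy0.ne']
      have h2 : |y| ≤ |2 * t| / h (2 * t) * h y := by
        rw [div_mul_eq_mul_div, le_div_iff₀ hFt]
        calc |y| * h (2 * t) ≤ |y| * (|2 * t| / |y| * h y) := by gcongr
          _ = _ := by field_simp
      nlinarith [mul_nonneg hs.le hy]
  -- `h` vanishes near the origin; adding `|y|` makes the modular of `H` control `p`-th moments
  have hg := hh.add isEvenConvex_abs
  refine ⟨p, fun y => (h y + |y|) ^ p, (2 * (D + 1)) ^ p * (2 * ℓ + 1), c, hp,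
    hg.isUniformlyEvenConvex_rpow hp, fun y => ?_, fun y => ?_, fun y => ?_⟩
  · exact Real.rpow_le_rpow (abs_nonneg y) (by linarith [hh.nonneg y]) hp0.le
  · have hy := hh.nonneg y
    have h1 : h y + |y| ≤ 2 * (D + 1) * max (h y) 1 := by
      have h2 := hD y
      have h3 := le_max_left (h y) 1
      have h4 := le_max_right (h y) 1
      nlinarith
    have h2 : max (h y) 1 ^ p ≤ (2 * ℓ + 1) * (Ψ y + 1) := by
      have hΨ0 := hΨ.nonneg y
      rcases le_total (h y) 1 with h3 | h3
      · rw [max_eq_right h3, Real.one_rpow]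
        nlinarith
      · rw [max_eq_left h3]
        calc h y ^ p ≤ (ℓ * ρ y) ^ p := Real.rpow_le_rpow hy (hup y) hp0.le
          _ = 2 * ℓ * F y := by rw [Real.mul_rpow (by linarith) (hρ0 y), hρp, hℓp]
          _ ≤ 2 * ℓ * Ψ y := by
              have : F y ≤ Ψ y := max_le (by linarith) hΨ0
              gcongr
          _ ≤ _ := by nlinarith
    calc (h y + |y|) ^ p ≤ (2 * (D + 1) * max (h y) 1) ^ p :=
          Real.rpow_le_rpow (by positivity) h1 hp0.le
      _ = (2 * (D + 1)) ^ p * max (h y) 1 ^ p :=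
          Real.mul_rpow (by positivity) (by positivity)
      _ ≤ _ := by
          rw [mul_assoc]
          gcongr
  · have h1 := hlow (1 / 2 * y)
    rw [show 2 * (1 / 2 * y) = y by ring] at h1
    have h2 : F (1 / 2 * y) ≤ (h y + |y|) ^ p := by
      rw [← hρp]
      exact Real.rpow_le_rpow (hρ0 _) (by linarith [abs_nonneg y]) hp0.le
    have h3 : Ψ (1 / 2 * y) - c ≤ F (1 / 2 * y) := le_max_left _ _
    linarith

/-! ### Almost minimising sequences of forward convex combinations -/

/-- In a decreasing sequence of convex sets, almost minimisers of a bounded functional have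
asymptotically vanishing midpoint defect. No convexity of the functional is used: the midpoint lies
in an earlier set, whose infimum is already close to the limit of the infima. -/
theorem exists_seq_midpoint_defect_le {E : Type*} [AddCommGroup E] [Module ℝ E] {X : ℕ → Set E}
    (hX : Antitone X) (hconv : ∀ n, Convex ℝ (X n)) (hne : ∀ n, (X n).Nonempty) {J : E → ℝ}
    {M : ℝ} (h0 : ∀ g, 0 ≤ J g) (hM : ∀ n, ∀ g ∈ X n, J g ≤ M) :
    ∃ g : ℕ → E, (∀ n, g n ∈ X n) ∧ ∀ ε > 0, ∃ N, ∀ n ≥ N, ∀ m ≥ N,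
      (J (g n) + J (g m)) / 2 - J ((1 / 2 : ℝ) • (g n + g m)) ≤ ε := by
  set I : ℕ → ℝ := fun n => sInf (J '' X n)
  have hbdd : ∀ n, BddBelow (J '' X n) := fun n => ⟨0, by rintro _ ⟨g, _, rfl⟩; exact h0 g⟩
  have hI : ∀ n, ∀ g ∈ X n, I n ≤ J g := fun n g hg => csInf_le (hbdd n) ⟨g, hg, rfl⟩
  have hmono : Monotone I := fun m n hmn =>
    csInf_le_csInf (hbdd m) ((hne n).image J) (Set.image_mono (hX hmn))
  have hIM : BddAbove (Set.range I) := ⟨M, by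
    rintro _ ⟨n, rfl⟩
    obtain ⟨g, hg⟩ := hne n
    exact (hI n g hg).trans (hM n g hg)⟩
  have hex : ∀ n : ℕ, ∃ g ∈ X n, J g < I n + 1 / (n + 1) := fun n => by
    obtain ⟨_, ⟨g, hg, rfl⟩, hlt⟩ := exists_lt_of_csInf_lt ((hne n).image J)
      (show sInf (J '' X n) < I n + 1 / (n + 1) from lt_add_of_pos_right _ (by positivity))
    exact ⟨g, hg, hlt⟩
  choose g hgX hgJ using hex
  refine ⟨g, hgX, fun ε hε => ?_⟩
  have hlim : Tendsto (fun n : ℕ => I n - 1 / ((n : ℝ) + 1)) atTop (𝓝 ((⨆ n, I n) - 0)) :=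
    (tendsto_atTop_ciSup hmono hIM).sub tendsto_one_div_add_atTop_nhds_zero_nat
  obtain ⟨N, hN⟩ := (hlim.eventually_const_lt
    (show (⨆ n, I n) - ε < (⨆ n, I n) - 0 by linarith)).exists
  have hup : ∀ n ≥ N, J (g n) ≤ (⨆ n, I n) + 1 / ((N : ℝ) + 1) := fun n hn => by
    have h1 := le_ciSup hIM n
    have h2 : 1 / ((n : ℝ) + 1) ≤ 1 / ((N : ℝ) + 1) := by gcongr
    linarith [hgJ n]
  refine ⟨N, fun n hn m hm => ?_⟩
  have hmid : (1 / 2 : ℝ) • (g n + g m) ∈ X N := by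
    rw [smul_add]
    exact hconv N (hX hn (hgX n)) (hX hm (hgX m)) (by norm_num) (by norm_num) (by norm_num)
  linarith [hI N _ hmid, hup n hn, hup m hm]

/-! ### The modular of an even convex function -/

section Modular

variable {Ω : Type*} [MeasurableSpace Ω] {P : Measure Ω} {H : ℝ → ℝ}

theorem IsEvenConvex.measurable_ofReal_comp (hH : IsEvenConvex H) (f : Ω →ₘ[P] ℝ) :
    Measurable fun ω => ENNReal.ofReal (H (f ω)) :=
  (hH.continuous.measurable.comp f.stronglyMeasurable.measurable).ennreal_ofReal

theorem IsEvenConvex.convex_setOf_orliczModular_le (hH : IsEvenConvex H) (M : ENNReal) :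
    Convex ℝ {f : Ω →ₘ[P] ℝ | orliczModular H f ≤ M} := by
  intro f hf g hg a b ha hb hab
  calc orliczModular H (a • f + b • g)
      ≤ ∫⁻ ω, (ENNReal.ofReal a * ENNReal.ofReal (H (f ω))
          + ENNReal.ofReal b * ENNReal.ofReal (H (g ω))) ∂P := by
        refine lintegral_mono_ae ?_
        filter_upwards [AEEqFun.coeFn_add (a • f) (b • g), AEEqFun.coeFn_smul a f,
          AEEqFun.coeFn_smul b g] with ω h1 h2 h3
        rw [h1, Pi.add_apply, h2, h3, Pi.smul_apply, Pi.smul_apply, ← ENNReal.ofReal_mul ha,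
          ← ENNReal.ofReal_mul hb, ← ENNReal.ofReal_add (mul_nonneg ha (hH.nonneg _))
            (mul_nonneg hb (hH.nonneg _))]
        exact ENNReal.ofReal_le_ofReal
          (hH.convex.2 (Set.mem_univ _) (Set.mem_univ _) ha hb hab)
    _ = ENNReal.ofReal a * orliczModular H f + ENNReal.ofReal b * orliczModular H g := by
        rw [lintegral_add_left ((hH.measurable_ofReal_comp f).const_mul _),
          lintegral_const_mul _ (hH.measurable_ofReal_comp f),
          lintegral_const_mul _ (hH.measurable_ofReal_comp g)]
        rfl
    _ ≤ ENNReal.ofReal a * M + ENNReal.ofReal b * M := by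
        gcongr
        · exact hf
        · exact hg
    _ = M := by rw [← add_mul, ← ENNReal.ofReal_add ha hb, hab, ENNReal.ofReal_one, one_mul]

/-- The modular is lower semicontinuous for almost sure convergence, by Fatou's lemma. -/
theorem IsEvenConvex.orliczModular_le_of_tendsto (hH : IsEvenConvex H) {f : ℕ → Ω →ₘ[P] ℝ}
    {g : Ω →ₘ[P] ℝ} {M : ENNReal} (hf : ∀ᶠ n in atTop, orliczModular H (f n) ≤ M)
    (hfg : ∀ᵐ ω ∂P, Tendsto (fun n => f n ω) atTop (𝓝 (g ω))) : orliczModular H g ≤ M := by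
  calc orliczModular H g
      = ∫⁻ ω, liminf (fun n => ENNReal.ofReal (H (f n ω))) atTop ∂P := by
        refine lintegral_congr_ae ?_
        filter_upwards [hfg] with ω hω
        exact (((ENNReal.continuous_ofReal.comp hH.continuous).tendsto _).comp
          hω).liminf_eq.symm
    _ ≤ liminf (fun n => orliczModular H (f n)) atTop :=
        lintegral_liminf_le fun n => hH.measurable_ofReal_comp (f n)
    _ ≤ M := liminf_le_of_frequently_le' hf.frequently

/-- The defect inequality of a uniformly convex function, integrated; the terms are arranged so that
no subtraction in `[0, ∞]` occurs. -/
theorem IsEvenConvex.orliczModular_half_smul_sub_add_le (hH : IsEvenConvex H) {ε K : ℝ}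
    (hK : 0 ≤ K) (hε : 0 ≤ ε)
    (hdef : ∀ a b, H ((a - b) / 2) ≤ ε * (H a + H b) + K * ((H a + H b) / 2 - H ((a + b) / 2)))
    (f g : Ω →ₘ[P] ℝ) :
    orliczModular H ((1 / 2 : ℝ) • (f - g)) +
        ENNReal.ofReal K * orliczModular H ((1 / 2 : ℝ) • (f + g)) ≤
      ENNReal.ofReal (ε + K / 2) * (orliczModular H f + orliczModular H g) := by
  have e : ∀ k : Ω →ₘ[P] ℝ, orliczModular H k = ∫⁻ ω, ENNReal.ofReal (H (k ω)) ∂P := fun _ => rfl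
  simp only [e]
  rw [← lintegral_const_mul _ (hH.measurable_ofReal_comp _),
    ← lintegral_add_left (hH.measurable_ofReal_comp _),
    ← lintegral_add_left (hH.measurable_ofReal_comp _),
    ← lintegral_const_mul _ ((hH.measurable_ofReal_comp f).fun_add (hH.measurable_ofReal_comp g))]
  refine lintegral_mono_ae ?_
  filter_upwards [AEEqFun.coeFn_smul (1 / 2 : ℝ) (f - g), AEEqFun.coeFn_smul (1 / 2 : ℝ) (f + g),
    AEEqFun.coeFn_sub f g, AEEqFun.coeFn_add f g] with ω h1 h2 h3 h4
  have e1 : ((1 / 2 : ℝ) • (f - g)) ω = (f ω - g ω) / 2 := by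
    rw [h1, Pi.smul_apply, h3, Pi.sub_apply, smul_eq_mul]; ring
  have e2 : ((1 / 2 : ℝ) • (f + g)) ω = (f ω + g ω) / 2 := by
    rw [h2, Pi.smul_apply, h4, Pi.add_apply, smul_eq_mul]; ring
  have hf := hH.nonneg (f ω)
  have hg := hH.nonneg (g ω)
  rw [e1, e2, ← ENNReal.ofReal_mul hK, ← ENNReal.ofReal_add hf hg,
    ← ENNReal.ofReal_add (hH.nonneg _) (mul_nonneg hK (hH.nonneg _)),
    ← ENNReal.ofReal_mul (by positivity)]
  refine ENNReal.ofReal_le_ofReal ?_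
  linarith [hdef (f ω) (g ω)]

/-- A sequence with bounded modular has forward convex combinations that are Cauchy for the modular
of a uniformly convex function. -/
theorem IsUniformlyEvenConvex.exists_modular_cauchy (hH : IsUniformlyEvenConvex H)
    {ξ : ℕ → Ω →ₘ[P] ℝ} {M : ENNReal} (hM : M ≠ ⊤) (hξ : ∀ n, orliczModular H (ξ n) ≤ M) :
    ∃ g : ℕ → Ω →ₘ[P] ℝ, (∀ n, g n ∈ convexHull ℝ (ξ '' Set.Ici n)) ∧
      (∀ n, orliczModular H (g n) ≤ M) ∧ ∀ ε : ℝ, 0 < ε → ∃ N, ∀ n ≥ N, ∀ m ≥ N,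
        orliczModular H ((1 / 2 : ℝ) • (g n - g m)) ≤ ENNReal.ofReal ε := by
  have hX : ∀ n, convexHull ℝ (ξ '' Set.Ici n) ⊆ {f | orliczModular H f ≤ M} := fun n =>
    convexHull_min (by rintro _ ⟨k, _, rfl⟩; exact hξ k) (hH.convex_setOf_orliczModular_le M)
  obtain ⟨g, hg, hdef⟩ := exists_seq_midpoint_defect_le
    (X := fun n => convexHull ℝ (ξ '' Set.Ici n)) (J := fun f => (orliczModular H f).toReal)
    (M := M.toReal) (fun m n hmn => convexHull_mono (Set.image_mono (Set.Ici_subset_Ici.2 hmn)))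
    (fun n => convex_convexHull _ _)
    (fun n => ⟨ξ n, subset_convexHull _ _ ⟨n, Set.mem_Ici.2 le_rfl, rfl⟩⟩)
    (fun f => ENNReal.toReal_nonneg) (fun n f hf => ENNReal.toReal_mono hM (hX n hf))
  have hgM : ∀ n, orliczModular H (g n) ≤ M := fun n => hX n (hg n)
  refine ⟨g, hg, hgM, fun ε hε => ?_⟩
  have hM0 : 0 ≤ M.toReal := ENNReal.toReal_nonneg
  obtain ⟨K, hK, hpt⟩ := hH.defect (ε / (4 * (M.toReal + 1))) (by positivity)
  obtain ⟨N, hN⟩ := hdef (ε / (2 * (K + 1))) (by positivity)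
  refine ⟨N, fun n hn m hm => ?_⟩
  have hfin : ∀ n, orliczModular H (g n) ≠ ⊤ := fun n => ne_top_of_le_ne_top hM (hgM n)
  have hmid : orliczModular H ((1 / 2 : ℝ) • (g n + g m)) ≠ ⊤ := by
    refine ne_top_of_le_ne_top hM ?_
    rw [smul_add]
    exact hH.convex_setOf_orliczModular_le M (hgM n) (hgM m) (by norm_num) (by norm_num)
      (by norm_num)
  have hε' : 0 ≤ ε / (4 * (M.toReal + 1)) := by positivity
  have key := hH.orliczModular_half_smul_sub_add_le hK hε' hpt (g n) (g m)
  have hrhs : ENNReal.ofReal (ε / (4 * (M.toReal + 1)) + K / 2) *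
      (orliczModular H (g n) + orliczModular H (g m)) ≠ ⊤ :=
    ENNReal.mul_ne_top ENNReal.ofReal_ne_top (ENNReal.add_ne_top.2 ⟨hfin n, hfin m⟩)
  have hdiff : orliczModular H ((1 / 2 : ℝ) • (g n - g m)) ≠ ⊤ :=
    ne_top_of_le_ne_top hrhs (le_self_add.trans key)
  have key' := ENNReal.toReal_mono hrhs key
  rw [ENNReal.toReal_add hdiff (ENNReal.mul_ne_top ENNReal.ofReal_ne_top hmid),
    ENNReal.toReal_mul, ENNReal.toReal_mul, ENNReal.toReal_add (hfin n) (hfin m),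
    ENNReal.toReal_ofReal hK, ENNReal.toReal_ofReal (by positivity)] at key'
  have hJ : ∀ n, (orliczModular H (g n)).toReal ≤ M.toReal := fun n =>
    ENNReal.toReal_mono hM (hgM n)
  have h1 : ε / (4 * (M.toReal + 1)) *
      ((orliczModular H (g n)).toReal + (orliczModular H (g m)).toReal) ≤ ε / 2 := by
    calc _ ≤ ε / (4 * (M.toReal + 1)) * (2 * (M.toReal + 1)) := by
          gcongr
          linarith [hJ n, hJ m]
      _ = ε / 2 := by field_simp; norm_num
  have h2 : K * (((orliczModular H (g n)).toReal + (orliczModular H (g m)).toReal) / 2 -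
      (orliczModular H ((1 / 2 : ℝ) • (g n + g m))).toReal) ≤ ε / 2 := by
    calc _ ≤ K * (ε / (2 * (K + 1))) := by
          gcongr
          exact hN n hn m hm
      _ ≤ (K + 1) * (ε / (2 * (K + 1))) := by gcongr; linarith
      _ = ε / 2 := by field_simp
  rw [← ENNReal.ofReal_toReal hdiff]
  exact ENNReal.ofReal_le_ofReal (by linarith)

/-- If the modular dominates the `p`-th moment, then a sequence that is Cauchy for the modular at a
geometric rate converges almost surely. -/
theorem exists_ae_tendsto_of_modular_cauchy {p : ℝ} (hp : 1 ≤ p)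
    (hpow : ∀ y, |y| ^ p ≤ H y) {f : ℕ → Ω →ₘ[P] ℝ}
    (hf : ∀ N n m, N ≤ n → N ≤ m → orliczModular H ((1 / 2 : ℝ) • (f n - f m)) ≤
      ENNReal.ofReal (((1 / 2 : ℝ) ^ (N + 1)) ^ p)) :
    ∃ g : Ω →ₘ[P] ℝ, ∀ᵐ ω ∂P, Tendsto (fun n => f n ω) atTop (𝓝 (g ω)) := by
  have hp0 : 0 < p := by linarith
  have hae := Lp.ae_tendsto_of_cauchy_eLpNorm' (μ := P) (p := p)
    (f := fun n ω => (1 / 2 : ℝ) * f n ω) (B := fun N => ENNReal.ofReal ((1 / 2) ^ N))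
    (fun n => ((f n).stronglyMeasurable.const_mul _).aestronglyMeasurable) hp
    (by
      rw [← ENNReal.ofReal_tsum_of_nonneg (fun n => by positivity) summable_geometric_two]
      exact ENNReal.ofReal_ne_top)
    (fun N n m hn hm => by
      have h1 : ∫⁻ ω, ‖((fun ω => (1 / 2 : ℝ) * f n ω) - fun ω => (1 / 2 : ℝ) * f m ω) ω‖ₑ ^ p ∂P
          ≤ orliczModular H ((1 / 2 : ℝ) • (f n - f m)) := by
        refine lintegral_mono_ae ?_
        filter_upwards [AEEqFun.coeFn_smul (1 / 2 : ℝ) (f n - f m),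
          AEEqFun.coeFn_sub (f n) (f m)] with ω h1 h2
        rw [h1, Pi.smul_apply, h2, Pi.sub_apply, Pi.sub_apply, smul_eq_mul, ← mul_sub,
          Real.enorm_eq_ofReal_abs, ENNReal.ofReal_rpow_of_nonneg (abs_nonneg _) hp0.le]
        exact ENNReal.ofReal_le_ofReal (hpow _)
      rw [eLpNorm'_eq_lintegral_enorm]
      calc _ ≤ ENNReal.ofReal (((1 / 2 : ℝ) ^ (N + 1)) ^ p) ^ (1 / p) := by
            gcongr
            exact h1.trans (hf N n m hn hm)
        _ = ENNReal.ofReal ((1 / 2) ^ (N + 1)) := by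
            rw [ENNReal.ofReal_rpow_of_nonneg (by positivity) (by positivity), one_div p,
              Real.rpow_rpow_inv (by positivity) hp0.ne']
        _ < ENNReal.ofReal ((1 / 2) ^ N) := by
            refine (ENNReal.ofReal_lt_ofReal_iff (by positivity)).2 ?_
            exact pow_lt_pow_right_of_lt_one₀ (by norm_num) (by norm_num) (by omega))
  have hae' : ∀ᵐ ω ∂P, ∃ l : ℝ, Tendsto (fun n => f n ω) atTop (𝓝 l) := by
    filter_upwards [hae] with ω hω
    obtain ⟨l, hl⟩ := hω
    refine ⟨2 * l, (hl.const_mul 2).congr fun n => by ring⟩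
  obtain ⟨g, hg, hlim⟩ := measurable_limit_of_tendsto_metrizable_ae
    (fun n => (f n).stronglyMeasurable.measurable.aemeasurable) hae'
  refine ⟨AEEqFun.mk g hg.aestronglyMeasurable, ?_⟩
  filter_upwards [hlim, AEEqFun.coeFn_mk g hg.aestronglyMeasurable] with ω h1 h2
  rwa [h2]

/-- The supremum of a sequence is controlled, up to a dilation, by its limit and by the sum of the
modulars of the distances to the limit. For an unbounded sequence the left side is `0`. -/
theorem IsEvenConvex.map_iSup_abs_le (hH : IsEvenConvex H) (x : ℕ → ℝ) (l : ℝ) :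
    ENNReal.ofReal (H (1 / 8 * ⨆ n, |x n|)) ≤
      ENNReal.ofReal (H l) + ∑' n, ENNReal.ofReal (H ((x n - l) / 2)) := by
  have hs0 : 0 ≤ ⨆ n, |x n| := Real.iSup_nonneg fun n => abs_nonneg _
  rcases eq_or_lt_of_le hs0 with hs | hs
  · simp [← hs, hH.map_zero]
  -- some `|x k|` exceeds half the supremum, and
  -- `x k / 4` is the midpoint of `l / 2` and `(x k - l) / 2`
  · obtain ⟨k, hk⟩ := exists_lt_of_lt_ciSup (show (⨆ n, |x n|) / 2 < ⨆ n, |x n| by linarith)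
    have h1 : H (1 / 8 * ⨆ n, |x n|) ≤ H ((1 / 2 * l + (x k - l) / 2) / 2) := by
      refine hH.le_of_abs_le ?_
      rw [show (1 / 2 * l + (x k - l) / 2) / 2 = 1 / 4 * x k by ring, abs_mul, abs_mul,
        abs_of_nonneg hs0, abs_of_pos (by norm_num : (0 : ℝ) < 1 / 8),
        abs_of_pos (by norm_num : (0 : ℝ) < 1 / 4)]
      linarith
    have h2 := hH.map_midpoint_le (1 / 2 * l) ((x k - l) / 2)
    have h3 := hH.map_mul_le (by norm_num : (0 : ℝ) ≤ 1 / 2) (by norm_num) l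
    have h4 := hH.nonneg l
    have h5 := hH.nonneg ((x k - l) / 2)
    calc _ ≤ ENNReal.ofReal (H l + H ((x k - l) / 2)) :=
          ENNReal.ofReal_le_ofReal (by linarith)
      _ = ENNReal.ofReal (H l) + ENNReal.ofReal (H ((x k - l) / 2)) :=
          ENNReal.ofReal_add h4 h5
      _ ≤ _ := by
          gcongr
          exact ENNReal.le_tsum (f := fun n => ENNReal.ofReal (H ((x n - l) / 2))) k

/-- A sequence with bounded modular for a uniformly convex function has forward convex combinations
that converge almost surely and whose supremum has finite modular, up to a dilation. -/
theorem IsUniformlyEvenConvex.exists_order_convergent (hH : IsUniformlyEvenConvex H) {p : ℝ}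
    (hp : 1 ≤ p) (hpow : ∀ y, |y| ^ p ≤ H y) {ξ : ℕ → Ω →ₘ[P] ℝ} {M : ENNReal} (hM : M ≠ ⊤)
    (hξ : ∀ n, orliczModular H (ξ n) ≤ M) :
    ∃ (ξbar : ℕ → Ω →ₘ[P] ℝ) (ξlim ζ : Ω →ₘ[P] ℝ),
      (∀ n, ξbar n ∈ convexHull ℝ (ξ '' Set.Ici n)) ∧
      orliczModular H ξlim < ⊤ ∧ orliczModular H ((1 / 8 : ℝ) • ζ) < ⊤ ∧
      (∀ᵐ ω ∂P, IsLUB (Set.range fun n => |ξbar n ω|) (ζ ω)) ∧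
      ∀ᵐ ω ∂P, Tendsto (fun n => ξbar n ω) atTop (𝓝 (ξlim ω)) := by
  obtain ⟨g, hg, hgM, hcau⟩ := hH.exists_modular_cauchy hM hξ
  obtain ⟨φ, hφ, hφc⟩ := extraction_forall_of_eventually'
    (P := fun k N => ∀ n ≥ N, ∀ m ≥ N, orliczModular H ((1 / 2 : ℝ) • (g n - g m)) ≤
      ENNReal.ofReal (((1 / 2 : ℝ) ^ (k + 1)) ^ p))
    (fun k => by
      obtain ⟨N, hN⟩ := hcau (((1 / 2 : ℝ) ^ (k + 1)) ^ p) (by positivity)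
      exact ⟨N, fun N' hN' n hn m hm => hN n (hN'.trans hn) m (hN'.trans hm)⟩)
  set f : ℕ → Ω →ₘ[P] ℝ := fun k => g (φ k)
  have hf : ∀ N n m, N ≤ n → N ≤ m → orliczModular H ((1 / 2 : ℝ) • (f n - f m)) ≤
      ENNReal.ofReal (((1 / 2 : ℝ) ^ (N + 1)) ^ p) := fun N n m hn hm =>
    hφc N _ (hφ.monotone hn) _ (hφ.monotone hm)
  obtain ⟨l, hl⟩ := exists_ae_tendsto_of_modular_cauchy hp hpow hf
  have hmodl : orliczModular H l ≤ M :=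
    hH.orliczModular_le_of_tendsto (Eventually.of_forall fun n => hgM (φ n)) hl
  have hdist : ∀ k, orliczModular H ((1 / 2 : ℝ) • (f k - l)) ≤
      ENNReal.ofReal (((1 / 2 : ℝ) ^ (k + 1)) ^ p) := fun k => by
    refine hH.orliczModular_le_of_tendsto (f := fun m => (1 / 2 : ℝ) • (f k - f m))
      ((eventually_ge_atTop k).mono fun m hm => hf k k m le_rfl hm) ?_
    have h1 := ae_all_iff.2 fun m => AEEqFun.coeFn_smul (1 / 2 : ℝ) (f k - f m)
    have h2 := ae_all_iff.2 fun m => AEEqFun.coeFn_sub (f k) (f m)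
    filter_upwards [hl, h1, h2, AEEqFun.coeFn_smul (1 / 2 : ℝ) (f k - l),
      AEEqFun.coeFn_sub (f k) l] with ω hω h1 h2 h3 h4
    simp only [h1, h2, h3, h4, Pi.smul_apply, Pi.sub_apply]
    exact (hω.const_sub (f k ω)).const_smul (1 / 2 : ℝ)
  have hmeas : Measurable fun ω => ⨆ k, |f k ω| :=
    Measurable.iSup fun k => (f k).stronglyMeasurable.measurable.abs
  have hbdd : ∀ᵐ ω ∂P, BddAbove (Set.range fun k => |f k ω|) := by
    filter_upwards [hl] with ω hω
    exact hω.abs.bddAbove_range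
  obtain ⟨ζ, hζ⟩ : ∃ ζ : Ω →ₘ[P] ℝ, ζ =ᵐ[P] fun ω => ⨆ k, |f k ω| :=
    ⟨_, AEEqFun.coeFn_mk _ hmeas.aestronglyMeasurable⟩
  refine ⟨f, l, ζ, fun n => ?_,
    hmodl.trans_lt hM.lt_top, ?_, ?_, hl⟩
  · exact convexHull_mono (Set.image_mono (Set.Ici_subset_Ici.2 (hφ.id_le n))) (hg (φ n))
  · have hsum : ∑' k, orliczModular H ((1 / 2 : ℝ) • (f k - l)) ≠ ⊤ := by
      have hgeo : Summable fun k : ℕ => ((1 / 2 : ℝ) ^ (k + 1)) ^ p :=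
        Summable.of_nonneg_of_le (fun k => by positivity) (fun k => by
          calc ((1 / 2 : ℝ) ^ (k + 1)) ^ p ≤ ((1 / 2 : ℝ) ^ (k + 1)) ^ (1 : ℝ) :=
                Real.rpow_le_rpow_of_exponent_ge (by positivity)
                  (pow_le_one₀ (by norm_num) (by norm_num)) hp
            _ = (1 / 2 : ℝ) ^ (k + 1) := Real.rpow_one _)
          ((summable_nat_add_iff 1).2 summable_geometric_two)
      refine ne_top_of_le_ne_top ?_ (ENNReal.tsum_le_tsum hdist)
      rw [← ENNReal.ofReal_tsum_of_nonneg (fun k => by positivity) hgeo]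
      exact ENNReal.ofReal_ne_top
    have hle : orliczModular H ((1 / 8 : ℝ) • ζ) ≤
        orliczModular H l + ∑' k, orliczModular H ((1 / 2 : ℝ) • (f k - l)) := by
      calc _ ≤ ∫⁻ ω, (ENNReal.ofReal (H (l ω)) +
              ∑' k, ENNReal.ofReal (H (((1 / 2 : ℝ) • (f k - l) : Ω →ₘ[P] ℝ) ω))) ∂P := by
            refine lintegral_mono_ae ?_
            have h1 := ae_all_iff.2 fun k => AEEqFun.coeFn_smul (1 / 2 : ℝ) (f k - l)
            have h2 := ae_all_iff.2 fun k => AEEqFun.coeFn_sub (f k) l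
            filter_upwards [hζ, h1, h2, AEEqFun.coeFn_smul (1 / 8 : ℝ) ζ] with ω hm h1 h2 h3
            rw [h3, Pi.smul_apply, hm, smul_eq_mul]
            refine (hH.map_iSup_abs_le _ (l ω)).trans (le_of_eq ?_)
            congr 1
            refine tsum_congr fun k => ?_
            rw [h1, Pi.smul_apply, h2, Pi.sub_apply, smul_eq_mul, div_eq_inv_mul, one_div]
        _ = _ := by
            rw [lintegral_add_left (hH.measurable_ofReal_comp l),
              lintegral_tsum fun k => (hH.measurable_ofReal_comp _).aemeasurable]
            rfl
    exact hle.trans_lt (ENNReal.add_lt_top.2 ⟨hmodl.trans_lt hM.lt_top, hsum.lt_top⟩)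
  · filter_upwards [hbdd, hζ] with ω hb hm
    rw [hm]
    exact isLUB_ciSup hb

end Modular

/-! ### Conjugates of Young functions -/

theorem IsYoungFunction.isEvenConvex {Φ : ℝ → ℝ} (hΦ : IsYoungFunction Φ) : IsEvenConvex Φ :=
  ⟨hΦ.even, hΦ.convex, hΦ.map_zero⟩

theorem IsYoungFunction.le_youngConjugate {Φ : ℝ → ℝ} (hΦ : IsYoungFunction Φ) (x y : ℝ) :
    x * y - Φ x ≤ youngConjugate Φ y :=
  le_ciSup (hΦ.bddAbove_conjugate y) x

theorem IsYoungFunction.isEvenConvex_youngConjugate {Φ : ℝ → ℝ} (hΦ : IsYoungFunction Φ) :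
    IsEvenConvex (youngConjugate Φ) where
  even y := by
    refine (Equiv.neg ℝ).iSup_congr fun x => ?_
    simp [hΦ.even]
  convex := by
    refine ⟨convex_univ, fun x _ y _ a b ha hb hab => ciSup_le fun z => ?_⟩
    have h1 := mul_le_mul_of_nonneg_left (hΦ.le_youngConjugate z x) ha
    have h2 := mul_le_mul_of_nonneg_left (hΦ.le_youngConjugate z y) hb
    have h3 : Φ z = a * Φ z + b * Φ z := by rw [← add_mul, hab, one_mul]
    simp only [smul_eq_mul]
    linarith
  map_zero := by
    refine le_antisymm (ciSup_le fun x => by linarith [hΦ.nonneg x]) ?_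
    simpa [hΦ.map_zero] using hΦ.le_youngConjugate 0 0

/-- The `Δ₂`-condition as an inequality valid on the whole line, at the cost of an additive
constant. -/
theorem IsYoungFunction.exists_map_two_mul_le {Φ : ℝ → ℝ} (hΦ : IsYoungFunction Φ)
    (hΔ : SatisfiesDelta2 Φ) : ∃ k K : ℝ, 2 < k ∧ ∀ x, Φ (2 * x) ≤ k * Φ x + K := by
  obtain ⟨k, hk, -⟩ := EReal.lt_iff_exists_real_btwn.1 hΔ
  obtain ⟨r, hr⟩ := eventually_atTop.1 ((eventually_lt_of_limsup_lt hk).and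
    ((hΦ.coercive.eventually_gt_atTop 0).and (eventually_gt_atTop 0)))
  refine ⟨max k 3, Φ (2 * r), lt_max_of_lt_right (by norm_num), fun x => ?_⟩
  have h0 := hΦ.nonneg (2 * r)
  have h1 := hΦ.nonneg x
  have h2 : 0 ≤ max k 3 * Φ x := mul_nonneg (le_max_of_le_right (by norm_num)) h1
  rcases le_total r |x| with hx | hx
  · obtain ⟨h3, h4, h5⟩ := hr _ hx
    have h6 : Φ |x| = Φ x := le_antisymm (hΦ.isEvenConvex.le_of_abs_le (by simp))
      (hΦ.isEvenConvex.le_of_abs_le (by simp))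
    have h7 : Φ (2 * x) ≤ Φ (2 * |x|) := hΦ.isEvenConvex.le_of_abs_le (by simp [abs_mul])
    have h8 : 0 < Φ |x| := (div_pos_iff_of_pos_right h5).1 h4
    have h9 := (div_lt_iff₀ h8).1 (EReal.coe_lt_coe_iff.1 h3)
    have h10 : k * Φ x ≤ max k 3 * Φ x := mul_le_mul_of_nonneg_right (le_max_left _ _) h1
    rw [h6] at h9
    linarith
  · have : Φ (2 * x) ≤ Φ (2 * r) := hΦ.isEvenConvex.le_of_abs_le (by
      rw [abs_mul, abs_mul]
      exact mul_le_mul_of_nonneg_left (hx.trans (le_abs_self r)) (abs_nonneg 2))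
    linarith

/-- The `Δ₂`-condition for `Φ` dualises to superlinear growth of the conjugate. -/
theorem IsYoungFunction.exists_youngConjugate_growth {Φ : ℝ → ℝ} (hΦ : IsYoungFunction Φ)
    (hΔ : SatisfiesDelta2 Φ) : ∃ ℓ K : ℝ, 1 < ℓ ∧
      ∀ y, 2 * ℓ * youngConjugate Φ y ≤ youngConjugate Φ (ℓ * y) + K := by
  obtain ⟨k, K, hk, hK⟩ := hΦ.exists_map_two_mul_le hΔ
  refine ⟨k / 2, K, by linarith, fun y => ?_⟩
  rw [mul_div_cancel₀ k two_ne_zero, youngConjugate, Real.mul_iSup_of_nonneg (by linarith)]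
  refine ciSup_le fun x => ?_
  have h1 := hΦ.le_youngConjugate (2 * x) (k / 2 * y)
  have h2 := hK x
  have h3 : 2 * x * (k / 2 * y) = k * (x * y) := by ring
  rw [h3] at h1
  linarith

/-! ### Orlicz spaces and the Luxemburg norm -/

section Orlicz

variable {Ω : Type*} [MeasurableSpace Ω] {P : Measure Ω} {Ψ : ℝ → ℝ}

theorem orliczModular_smul (Ψ : ℝ → ℝ) (c : ℝ) (f : Ω →ₘ[P] ℝ) :
    orliczModular Ψ (c • f) = orliczModular (fun x => Ψ (c * x)) f := by
  refine lintegral_congr_ae ?_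
  filter_upwards [AEEqFun.coeFn_smul c f] with ω h
  rw [h, Pi.smul_apply, smul_eq_mul]

theorem IsEvenConvex.orliczModular_smul_mono (hΨ : IsEvenConvex Ψ) {c d : ℝ} (hc : 0 ≤ c)
    (hcd : c ≤ d) (f : Ω →ₘ[P] ℝ) : orliczModular Ψ (c • f) ≤ orliczModular Ψ (d • f) := by
  rw [orliczModular_smul, orliczModular_smul]
  refine lintegral_mono fun ω => ENNReal.ofReal_le_ofReal (hΨ.le_of_abs_le ?_)
  rw [abs_mul, abs_mul, abs_of_nonneg hc, abs_of_nonneg (hc.trans hcd)]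
  gcongr

/-- Every element of the Orlicz space lies in a multiple of the unit ball of the modular, so that
the infimum defining its Luxemburg norm is taken over a nonempty set. -/
theorem IsEvenConvex.exists_inv_smul_mem_orliczBall (hΨ : IsEvenConvex Ψ) {f : Ω →ₘ[P] ℝ}
    (hf : f ∈ orliczSpace Ψ P) : {c : ℝ | 0 < c ∧ c⁻¹ • f ∈ orliczBall Ψ P}.Nonempty := by
  obtain ⟨c, hc, hfin⟩ := hf
  set m := (orliczModular Ψ (c • f)).toReal
  have hm : 0 ≤ m := ENNReal.toReal_nonneg
  have hs1 : (m + 1)⁻¹ ≤ 1 := inv_le_one_of_one_le₀ (by linarith)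
  refine ⟨((m + 1)⁻¹ * c)⁻¹, by positivity, ?_⟩
  change orliczModular Ψ (((m + 1)⁻¹ * c)⁻¹⁻¹ • f) ≤ 1
  rw [inv_inv]
  calc orliczModular Ψ (((m + 1)⁻¹ * c) • f)
      ≤ ENNReal.ofReal (m + 1)⁻¹ * orliczModular Ψ (c • f) := by
        rw [orliczModular_smul, orliczModular_smul, orliczModular, orliczModular,
          ← lintegral_const_mul _ ((hΨ.comp_mul c).measurable_ofReal_comp f)]
        refine lintegral_mono fun ω => ?_
        rw [← ENNReal.ofReal_mul (by positivity), mul_assoc]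
        exact ENNReal.ofReal_le_ofReal (hΨ.map_mul_le (by positivity) hs1 _)
    _ = ENNReal.ofReal ((m + 1)⁻¹ * m) := by
        rw [ENNReal.ofReal_mul (by positivity), ENNReal.ofReal_toReal hfin.ne]
    _ ≤ 1 := by
        rw [← ENNReal.ofReal_one]
        refine ENNReal.ofReal_le_ofReal ?_
        rw [inv_mul_le_iff₀ (by linarith)]
        linarith

theorem IsEvenConvex.orliczModular_inv_smul_le_one (hΨ : IsEvenConvex Ψ) {f : Ω →ₘ[P] ℝ}
    (hf : f ∈ orliczSpace Ψ P) {C : ℝ} (hC : luxemburgNorm Ψ f < C) :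
    orliczModular Ψ (C⁻¹ • f) ≤ 1 := by
  obtain ⟨c, ⟨hc, hcb⟩, hlt⟩ :=
    exists_lt_of_csInf_lt (hΨ.exists_inv_smul_mem_orliczBall hf) hC
  have hC0 : 0 < C := hc.trans hlt
  exact (hΨ.orliczModular_smul_mono (inv_nonneg.2 hC0.le) (inv_anti₀ hc hlt.le) f).trans hcb

theorem orliczModular_le_of_le [IsProbabilityMeasure P] {G H : ℝ → ℝ} {A : ℝ}
    (hG : IsEvenConvex G) (hle : ∀ y, H y ≤ A * (G y + 1)) (f : Ω →ₘ[P] ℝ) :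
    orliczModular H f ≤ ENNReal.ofReal A * (orliczModular G f + 1) := by
  calc orliczModular H f
      ≤ ∫⁻ ω, ENNReal.ofReal A * (ENNReal.ofReal (G (f ω)) + 1) ∂P := by
        refine lintegral_mono fun ω => ?_
        have h0 := hG.nonneg (f ω)
        rw [← ENNReal.ofReal_one, ← ENNReal.ofReal_add h0 zero_le_one,
          ← ENNReal.ofReal_mul' (by linarith)]
        exact ENNReal.ofReal_le_ofReal (hle _)
    _ = _ := by
        rw [lintegral_const_mul _ ((hG.measurable_ofReal_comp f).add_const 1),
          lintegral_add_left (hG.measurable_ofReal_comp f), lintegral_one, measure_univ]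
        rfl

theorem mem_orliczSpace_of_le [IsProbabilityMeasure P] {H : ℝ → ℝ} {c s B : ℝ}
    (hH : IsEvenConvex H) (hc : 0 < c) (hs : 0 < s) (hle : ∀ y, Ψ (c * y) ≤ H y + B)
    {f : Ω →ₘ[P] ℝ} (hf : orliczModular H (s • f) < ⊤) : f ∈ orliczSpace Ψ P := by
  refine ⟨c * s, mul_pos hc hs, ?_⟩
  rw [orliczModular_smul] at hf ⊢
  calc orliczModular (fun x => Ψ (c * s * x)) f
      ≤ ∫⁻ ω, (ENNReal.ofReal (H (s * f ω)) + ENNReal.ofReal B) ∂P := by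
        refine lintegral_mono fun ω => ?_
        refine le_trans (ENNReal.ofReal_le_ofReal ?_) ENNReal.ofReal_add_le
        simp only [mul_assoc]
        exact hle _
    _ = orliczModular (fun x => H (s * x)) f + ENNReal.ofReal B := by
        rw [lintegral_add_left ((hH.comp_mul s).measurable_ofReal_comp f), lintegral_const,
          measure_univ, mul_one]
        rfl
    _ < ⊤ := ENNReal.add_lt_top.2 ⟨hf, ENNReal.ofReal_lt_top⟩

end Orlicz

/-! ### Order convergence of forward convex combinations -/

theorem corollary3p9 {Ω : Type*} [MeasurableSpace Ω] (P : Measure Ω) [IsProbabilityMeasure P]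
    (Φ : ℝ → ℝ) (hΦ : IsYoungFunction Φ) (hΔ : SatisfiesDelta2 Φ)
    (ξ : ℕ → Ω →ₘ[P] ℝ)
    (hξ : ∀ n, ξ n ∈ orliczSpace (youngConjugate Φ) P)
    (hbdd : ∃ C : ℝ, ∀ n, luxemburgNorm (youngConjugate Φ) (ξ n) ≤ C) :
    ∃ (ξbar : ℕ → Ω →ₘ[P] ℝ) (ξlim : Ω →ₘ[P] ℝ),
      (∀ n, ξbar n ∈ convexHull ℝ (ξ '' Set.Ici n)) ∧
      ξlim ∈ orliczSpace (youngConjugate Φ) P ∧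
      (∃ ζ ∈ orliczSpace (youngConjugate Φ) P,
        ∀ᵐ ω ∂P, IsLUB (Set.range fun n => |ξbar n ω|) (ζ ω)) ∧
      ∀ᵐ ω ∂P, Tendsto (fun n => ξbar n ω) atTop (𝓝 (ξlim ω)) := by
  obtain ⟨C₀, hC₀⟩ := hbdd
  set C := |C₀| + 1
  have hC : 0 < C := by positivity
  have hΨ := hΦ.isEvenConvex_youngConjugate
  have hball : ∀ n, orliczModular (youngConjugate Φ) (C⁻¹ • ξ n) ≤ 1 := fun n =>
    hΨ.orliczModular_inv_smul_le_one (hξ n)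
      (by have := hC₀ n; have := le_abs_self C₀; simp only [C]; linarith)
  obtain ⟨ℓ, K, hℓ, hK⟩ := hΦ.exists_youngConjugate_growth hΔ
  -- the growth inequality is invariant under dilations, so the bound `C` on the norms can be
  -- absorbed into the conjugate function
  have hΨC := hΨ.comp_mul C⁻¹
  obtain ⟨p, H, A, B, hp, hH, hpow, hup, hlow⟩ := hΨC.exists_isUniformlyEvenConvex hℓ
    (fun y => by rw [mul_left_comm]; exact hK _)
    (fun M => ⟨C * (M + Φ 1 + 1), by
      have := hΦ.le_youngConjugate 1 (C⁻¹ * (C * (M + Φ 1 + 1)))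
      rw [inv_mul_cancel_left₀ hC.ne'] at this ⊢
      linarith⟩)
  obtain ⟨ξbar, ξlim, ζ, hconv, hlimfin, hζfin, hLUB, hlim⟩ :=
    hH.exists_order_convergent hp.le hpow (ξ := ξ) (M := ENNReal.ofReal A * (1 + 1))
      (ENNReal.mul_ne_top ENNReal.ofReal_ne_top (by norm_num))
      (fun n => (orliczModular_le_of_le hΨC hup (ξ n)).trans (by
        gcongr
        rw [← orliczModular_smul]
        exact hball n))
  have hlow' : ∀ y, youngConjugate Φ (C⁻¹ * (1 / 2) * y) ≤ H y + B := fun y => by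
    rw [mul_assoc]
    exact hlow y
  refine ⟨ξbar, ξlim, hconv, ?_, ⟨ζ, ?_, hLUB⟩, hlim⟩
  · exact mem_orliczSpace_of_le hH.toIsEvenConvex (by positivity) one_pos hlow'
      (by rwa [one_smul])
  · exact mem_orliczSpace_of_le hH.toIsEvenConvex (by positivity) (by norm_num) hlow' hζfin
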